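/- All matrices have integer entries. A quiver $Q$ has a finite totally ordered set of vertices $1,\dots,m$ and of arrows $1,\dots,n$, each arrow $i$ having a source $s(i)$ and a target $t(i)$. Its incidence matrix $I(Q)$ is the $m\times n$ matrix with $i$-th column $e_{s(i)}-e_{t(i)}$. Let $\check G_Q$ be the unique upper triangular matrix with $\check G_Q+\check G_Q^{\mathrm{tr}}=I(Q)^{\mathrm{tr}}I(Q)$, and let $q_Q(x)=\tfrac12\|I(Q)x\|^2$ for $x\in\mathbb Z^n$. If $Q$ is loop-less (no arrow has equal source and target), then $\check G_Q$ is $\mathbb Z$-invertible, and the inverse quiver $Q^\dagger$ is the quiver with $I(Q^\dagger)=I(Q)\check G_Q^{-1}$. Explicitly, the target (source) of the arrow $i$ of $Q^\dagger$ is the end of the walk in $Q$ which starts at $t(i)$ (at $s(i)$) and traverses arrows smaller than $i$ in descending order, the next arrow always being the largest arrow below the previous one that is incident to the current vertex, until there is none. Let $\pi=(\pi_1\ge\dots\ge\pi_\ell)$ be a partition of $m\ge2$, let $d\ge0$, and put $v_t=m-(\pi_1+\dots+\pi_t)$. The standard quiver $\vec{\mathbb A}^d[\pi]$ has vertices $1,\dots,m$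 and, in this order, the arrows $i_t:t\to t+1$ $(1\le t\le m-1)$, $j_t:v_{t-1}\to v_t$ $(1\le t\le \ell-1)$ and $k_1,\dots,k_{2d}$, where $k_t$ is parallel to $\alpha$ for even $t$ and antiparallel to $\alpha$ for odd $t$, with $\alpha=i_{m-1}$ if $\ell=1$ and $\alpha=j_{\ell-1}$ if $\ell>1$. For quivers $Q,\tilde Q$ with the same numbers of vertices and arrows, a square matrix $B$ is a pseudo-morphism from $Q$ to $\tilde Q$ if $I(Q)B=I(\tilde Q)$ and $I(\tilde Q^\dagger)B^{\mathrm{tr}}=I(Q^\dagger)$; for any $n\times n$ matrix $N$ regarded as going from $Q$ to $\tilde Q$ put $N^*=\check G_{\tilde Q}^{-1}N^{\mathrm{tr}}\check G_Q$. For an integral quadratic form $q$ on $\mathbb Z^n$ let $\check G_q$ be the upper triangular matrix with $q(x)=x^{\mathrm{tr}}\check G_q x$; $q$ is a unit form if $q(e_i)=1$ for all $i$. A strong Gram congruence from a unit form $q$ to a unit form $q'$ is a $\mathbb Z$-invertible matrix $N$ with $\check G_{q'}=N^{\mathrm{tr}}\check G_qN$. **Proposition.** Let $Q$ be a connected loop-less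 quiver, let $\vec Q$ be a standard quiver with the same numbers of vertices and arrows as $Q$, and let $B$ be a $\mathbb Z$-invertible pseudo-morphism from $Q$ to $\vec Q$. Then there is a matrix $C$ with $$I(Q)(BC)=I(\vec Q)\qquad\text{and}\qquad (BC)^*(BC)=\mathrm{Id},$$ and $BC$ is a strong Gram congruence from $q_Q$ to $q_{\vec Q}$. -/

import Mathlib

/-- A finite quiver whose vertices and arrows are numbered: `m` vertices and `n` arrows, in their
natural orders (numbered from `0`, instead of from `1`). -/
structure FinQuiver (m n : ℕ) where
  /-- source of an arrow -/
  src : Fin n → Fin m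
  /-- target of an arrow -/
  tgt : Fin n → Fin m

namespace FinQuiver

variable {m n : ℕ}

/-- No arrow has the same source and target. -/
def Loopless (Q : FinQuiver m n) : Prop := ∀ i, Q.src i ≠ Q.tgt i

/-- The underlying graph of the quiver is connected. -/
def Connected (Q : FinQuiver m n) : Prop :=
  (SimpleGraph.fromRel fun u v => ∃ i, Q.src i = u ∧ Q.tgt i = v).Connected

/-- The incidence matrix `I(Q)`: its `i`-th column is `e_{s(i)} - e_{t(i)}`. -/
def inc (Q : FinQuiver m n) : Matrix (Fin m) (Fin n) ℤ :=
  Matrix.of fun v i => (Pi.single (Q.src i) 1 - Pi.single (Q.tgt i) 1 : Fin m → ℤ) v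

/-- The symmetric Gram matrix `G_Q = I(Q)ᵀ I(Q)`. -/
def gram (Q : FinQuiver m n) : Matrix (Fin n) (Fin n) ℤ := Q.inc.transpose * Q.inc

/-- The upper triangular Gram matrix: the upper triangular matrix `U` with `U + Uᵀ = G_Q`. The
diagonal of `G_Q` is even, so that the division is exact, see `upperGram_add_transpose`. -/
def upperGram (Q : FinQuiver m n) : Matrix (Fin n) (Fin n) ℤ :=
  Matrix.of fun i j => if i < j then Q.gram i j else if i = j then Q.gram i i / 2 else 0

/-- The end of the walk which starts at the vertex `v` and traverses arrows of number smaller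
than `k` only, in descending order, where each next arrow is the largest one below its predecessor
(below `k` for the first one) that is incident to the vertex reached so far, until there is none. -/
def descend (Q : FinQuiver m n) : ℕ → Fin m → Fin m
  | 0, v => v
  | k + 1, v =>
      Q.descend k (if h : k < n then Equiv.swap (Q.src ⟨k, h⟩) (Q.tgt ⟨k, h⟩) v else v)

/-- The inverse quiver `Q†`, built from the descending structural walks of `Q`: its arrow `i` ends
where the structural walk through `i` in positive direction ends, and it starts where the
structural walk through `i` in the opposite direction ends. It is the quiver with incidence matrix
`I(Q)` times the inverse of the upper triangular Gram matrix, see `inc_dagger`. -/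
def dagger (Q : FinQuiver m n) : FinQuiver m n where
  src i := Q.descend i (Q.src i)
  tgt i := Q.descend i (Q.tgt i)

theorem gram_diag (Q : FinQuiver m n) (i : Fin n) :
    Q.gram i i = if Q.src i = Q.tgt i then 0 else 2 := by
  have : Q.gram i i = (Pi.single (Q.src i) 1 - Pi.single (Q.tgt i) 1 : Fin m → ℤ) ⬝ᵥ
      (Pi.single (Q.src i) 1 - Pi.single (Q.tgt i) 1) := rfl
  rw [this]
  split_ifs with h
  · simp [h]
  · simp [h, Ne.symm h]

theorem upperGram_add_transpose (Q : FinQuiver m n) :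
    Q.upperGram + Q.upperGram.transpose = Q.gram := by
  have hs : ∀ i j, Q.gram i j = Q.gram j i := fun i j => by
    simp [gram, Matrix.mul_apply, mul_comm]
  ext i j
  rcases lt_trichotomy i j with h | h | h
  · simp [upperGram, h, h.not_gt, h.ne']
  · subst h
    have := Q.gram_diag i
    simp only [upperGram, Matrix.add_apply, Matrix.transpose_apply, Matrix.of_apply, lt_irrefl,
      if_true, if_false]
    split_ifs at this <;> omega
  · simp [upperGram, h, h.not_gt, h.ne', hs i j]

theorem det_upperGram (Q : FinQuiver m n) (hQ : Q.Loopless) : Q.upperGram.det = 1 := by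
  rw [Matrix.det_of_isUpperTriangular]
  · refine Finset.prod_eq_one fun i _ => ?_
    simp [upperGram, gram_diag, hQ i]
  · intro i j h
    have h' : j < i := h
    simp [upperGram, h'.not_gt, h'.ne']

theorem single_descend (Q : FinQuiver m n) (w : Fin m) (k : ℕ) (v : Fin m) :
    (Pi.single (Q.descend k v) 1 : Fin m → ℤ) w = (Pi.single v 1 : Fin m → ℤ) w -
      ∑ i : Fin n, if (i : ℕ) < k then Q.dagger.inc w i * Q.inc v i else 0 := by
  induction k generalizing v with
  | zero => simp [descend]
  | succ k ih =>
    by_cases hk : k < n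
    · have hsum : ∀ f : Fin n → ℤ, (∑ i : Fin n, if (i : ℕ) < k + 1 then f i else 0) =
          (∑ i : Fin n, if (i : ℕ) < k then f i else 0) + f ⟨k, hk⟩ := by
        intro f
        rw [← Finset.add_sum_erase _ _ (Finset.mem_univ (⟨k, hk⟩ : Fin n)),
          ← Finset.add_sum_erase _ (fun i : Fin n => if (i : ℕ) < k then f i else 0)
            (Finset.mem_univ (⟨k, hk⟩ : Fin n))]
        simp only [lt_add_iff_pos_right, zero_lt_one, if_true, lt_irrefl, if_false, zero_add]
        rw [add_comm]
        congr 1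
        refine Finset.sum_congr rfl fun i hi => ?_
        have : (i : ℕ) ≠ k := fun h => (Finset.mem_erase.1 hi).1 (Fin.ext h)
        have h2 : (i : ℕ) < k + 1 ↔ (i : ℕ) < k := by omega
        simp only [h2]
      rw [hsum, ← sub_sub, ← ih v]
      have hX : Q.dagger.inc w ⟨k, hk⟩ = (Pi.single (Q.descend k (Q.src ⟨k, hk⟩)) 1 : Fin m → ℤ) w -
          (Pi.single (Q.descend k (Q.tgt ⟨k, hk⟩)) 1 : Fin m → ℤ) w := rfl
      have hI : Q.inc v ⟨k, hk⟩ = (if v = Q.src ⟨k, hk⟩ then 1 else 0) -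
          (if v = Q.tgt ⟨k, hk⟩ then 1 else 0) := by
        simp [inc, Pi.single_apply]
      rw [hX, hI]
      simp only [descend, hk, dif_pos, Equiv.swap_apply_def]
      by_cases h1 : v = Q.src ⟨k, hk⟩ <;> by_cases h2 : v = Q.tgt ⟨k, hk⟩
      · rw [if_pos h1, if_pos h1, if_pos h2, ← h2]; ring
      · rw [if_pos h1, if_pos h1, if_neg h2, ← h1]; ring
      · rw [if_neg h1, if_pos h2, if_neg h1, if_pos h2, ← h2]; ring
      · rw [if_neg h1, if_neg h2, if_neg h1, if_neg h2]; ring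
    · simp only [descend, hk, dif_neg, not_false_eq_true]
      rw [ih]
      congr 1
      refine Finset.sum_congr rfl fun i _ => ?_
      have h1 : (i : ℕ) < k := by omega
      have h2 : (i : ℕ) < k + 1 := by omega
      simp [h1, h2]

/-- The incidence matrix of the inverse quiver. -/
theorem inc_dagger (Q : FinQuiver m n) (hQ : Q.Loopless) :
    Q.dagger.inc = Q.inc * Q.upperGram⁻¹ := by
  have key : Q.dagger.inc * Q.upperGram = Q.inc := by
    ext w j
    have hc : ∀ i, Q.inc (Q.src j) i - Q.inc (Q.tgt j) i = Q.gram i j := by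
      intro i
      have : Q.gram i j = (fun v => Q.inc v i) ⬝ᵥ
        (Pi.single (Q.src j) 1 - Pi.single (Q.tgt j) 1 : Fin m → ℤ) := rfl
      rw [this]; simp [dotProduct_sub]
    have h : Q.dagger.inc w j = Q.inc w j -
        ∑ i : Fin n, if i < j then Q.dagger.inc w i * Q.gram i j else 0 := by
      have e : Q.dagger.inc w j = (Pi.single (Q.descend j (Q.src j)) 1 : Fin m → ℤ) w -
          (Pi.single (Q.descend j (Q.tgt j)) 1 : Fin m → ℤ) w := rfl
      have e' : Q.inc w j = (Pi.single (Q.src j) 1 : Fin m → ℤ) w -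
          (Pi.single (Q.tgt j) 1 : Fin m → ℤ) w := rfl
      rw [e, single_descend, single_descend, e', sub_sub_sub_comm, ← Finset.sum_sub_distrib]
      congr 1
      refine Finset.sum_congr rfl fun i _ => ?_
      simp only [← hc i, Fin.lt_def]
      split_ifs <;> ring
    have h2 : ∀ i, Q.dagger.inc w i * Q.upperGram i j =
        (if i < j then Q.dagger.inc w i * Q.gram i j else 0) +
          if i = j then Q.dagger.inc w i else 0 := by
      intro i
      rcases lt_trichotomy i j with h | h | h
      · simp [upperGram, h, h.ne]
      · subst h; simp [upperGram, gram_diag, hQ i]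
      · simp [upperGram, h.not_gt, h.ne']
    rw [Matrix.mul_apply, Finset.sum_congr rfl fun i _ => h2 i, Finset.sum_add_distrib,
      Finset.sum_ite_eq' Finset.univ j, if_pos (Finset.mem_univ j)]
    linarith
  have hu : IsUnit Q.upperGram.det := by rw [Q.det_upperGram hQ]; exact isUnit_one
  rw [← key, Matrix.mul_nonsing_inv_cancel_right _ _ hu]

theorem even_normSq (Q : FinQuiver m n) (x : Fin n → ℤ) :
    Even (Q.inc.mulVec x ⬝ᵥ Q.inc.mulVec x) := by
  have h : Q.inc.mulVec x ⬝ᵥ Q.inc.mulVec x = 2 * (x ⬝ᵥ Q.upperGram.mulVec x) := by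
    have h1 : Q.inc.mulVec x ⬝ᵥ Q.inc.mulVec x = x ⬝ᵥ Q.gram.mulVec x := by
      rw [gram, ← Matrix.mulVec_mulVec, Matrix.dotProduct_mulVec x, Matrix.vecMul_transpose]
    rw [h1, ← upperGram_add_transpose, Matrix.add_mulVec, dotProduct_add, Matrix.mulVec_transpose,
      dotProduct_comm x (Matrix.vecMul x _), ← Matrix.dotProduct_mulVec]
    ring
  rw [h]; exact even_two_mul _

/-- The integral quadratic form `q_Q(x) = ½ ‖I(Q) x‖²` (the division is exact). -/
def form (Q : FinQuiver m n) : QuadraticForm ℤ (Fin n → ℤ) where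
  toFun x := (Q.inc.mulVec x ⬝ᵥ Q.inc.mulVec x) / 2
  toFun_smul a x := by
    obtain ⟨k, hk⟩ := Q.even_normSq x
    have h1 : Q.inc.mulVec (a • x) ⬝ᵥ Q.inc.mulVec (a • x) = 2 * (a * a * k) := by
      rw [Matrix.mulVec_smul, smul_dotProduct, dotProduct_smul, hk, smul_eq_mul, smul_eq_mul]
      ring
    have h2 : Q.inc.mulVec x ⬝ᵥ Q.inc.mulVec x = 2 * k := by rw [hk]; ring
    rw [h1, h2, smul_eq_mul]
    simp
  exists_companion' := by
    refine ⟨Matrix.toBilin' Q.gram, fun x y => ?_⟩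
    obtain ⟨k, hk⟩ := Q.even_normSq x
    obtain ⟨l, hl⟩ := Q.even_normSq y
    have hb : Matrix.toBilin' Q.gram x y = Q.inc.mulVec x ⬝ᵥ Q.inc.mulVec y := by
      rw [Matrix.toBilin'_apply', gram, ← Matrix.mulVec_mulVec, Matrix.dotProduct_mulVec x,
        Matrix.vecMul_transpose]
    have h1 : Q.inc.mulVec (x + y) ⬝ᵥ Q.inc.mulVec (x + y) =
        2 * (k + l + Q.inc.mulVec x ⬝ᵥ Q.inc.mulVec y) := by
      rw [Matrix.mulVec_add, add_dotProduct, dotProduct_add, dotProduct_add, hk, hl,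
        dotProduct_comm (Q.inc.mulVec y) (Q.inc.mulVec x)]
      ring
    rw [h1, hb, hk, hl]
    omega

/-- `B` is a pseudo-morphism from `Q` to `R`. -/
def IsPseudoMorphism (Q R : FinQuiver m n) (B : Matrix (Fin n) (Fin n) ℤ) : Prop :=
  Q.inc * B = R.inc ∧ R.dagger.inc * B.transpose = Q.dagger.inc

/-- The matrix `B*`, for a matrix `B` regarded as going from `Q` to `R`. -/
noncomputable def starMatrix (Q R : FinQuiver m n) (B : Matrix (Fin n) (Fin n) ℤ) :
    Matrix (Fin n) (Fin n) ℤ :=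
  R.upperGram⁻¹ * B.transpose * Q.upperGram

/-- For a partition `π₁ ≥ … ≥ π_ℓ` of `m`, the vertex `v_t = m - (π₁ + … + π_t)` for `t < ℓ`,
where the vertices `1, …, m` are numbered `0, …, m - 1`. -/
def partVertex (hm : 2 ≤ m) (π : m.Partition) (t : ℕ) : Fin m :=
  ⟨m - ((π.parts.sort (· ≥ ·)).take t).sum - 1, by omega⟩

/-- The arrow `α` that is doubled in a standard quiver, as the pair of its source and its
target: the last arrow `m - 1 → m` of the linear quiver if `ℓ = 1`, and the last of the arrows
`v_{t-1} → v_t` if `ℓ > 1`. -/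
def lastArrow (hm : 2 ≤ m) (π : m.Partition) : Fin m × Fin m :=
  if π.parts.card = 1 then (⟨m - 2, by omega⟩, ⟨m - 1, by omega⟩)
  else (partVertex hm π (π.parts.card - 2), partVertex hm π (π.parts.card - 1))

/-- Source and target of the arrow number `a` (counted from `0`) of the standard quiver with cycle
type `π` and degeneracy degree `d`. First come the `m - 1` arrows of the linear quiver, then the
`ℓ - 1` arrows `v_{t-1} → v_t`, `1 ≤ t ≤ ℓ - 1`, then the arrows `k_1, …, k_{2d}`, where `k_t` is
parallel to `α` if `t` is even and antiparallel to `α` if `t` is odd. -/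
def standardArrow (hm : 2 ≤ m) (π : m.Partition) (a : ℕ) : Fin m × Fin m :=
  if h : a < m - 1 then (⟨a, by omega⟩, ⟨a + 1, by omega⟩)
  else if a < (m - 1) + (π.parts.card - 1) then
    (partVertex hm π (a - (m - 1)), partVertex hm π (a - (m - 1) + 1))
  else if Odd (a - ((m - 1) + (π.parts.card - 1)) + 1) then (lastArrow hm π).swap
  else lastArrow hm π

/-- The standard quiver with cycle type `π` and degeneracy degree `d`. -/
def standard (hm : 2 ≤ m) (π : m.Partition) (d : ℕ) :
    FinQuiver m ((m - 1) + (π.parts.card - 1) + 2 * d) where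
  src a := (standardArrow hm π a).1
  tgt a := (standardArrow hm π a).2

/-- `R` is a standard quiver, that is, `R` is `standard hm π d` for some `π` and `d`. -/
def IsStandard (R : FinQuiver m n) : Prop :=
  ∃ (hm : 2 ≤ m) (π : m.Partition) (d : ℕ) (h : (m - 1) + (π.parts.card - 1) + 2 * d = n),
    R = h ▸ standard hm π d

end FinQuiver

/-- The Gram matrix of the bilinear form belonging to the integral quadratic form `q` whose Gram
matrix is upper triangular. -/
def upperTriangularGram {n : ℕ} (q : QuadraticForm ℤ (Fin n → ℤ)) : Matrix (Fin n) (Fin n) ℤ :=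
  Matrix.of fun i j =>
    if i < j then QuadraticMap.polar q (Pi.single i 1) (Pi.single j 1)
    else if i = j then q (Pi.single i 1) else 0

/-- A unit form. -/
def IsUnitForm {n : ℕ} (q : QuadraticForm ℤ (Fin n → ℤ)) : Prop :=
  ∀ i, q (Pi.single i 1) = 1

/-- `B` is a strong Gram congruence between the unit forms `q` and `q'`. -/
def IsStrongGramCongruence {n : ℕ} (B : Matrix (Fin n) (Fin n) ℤ)
    (q q' : QuadraticForm ℤ (Fin n → ℤ)) : Prop :=
  IsUnitForm q ∧ IsUnitForm q' ∧ IsUnit B ∧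
    upperTriangularGram q' = B.transpose * upperTriangularGram q * B

/-! Write I = I(R), let G be the upper triangular Gram matrix of R, and let G' be that of Q
transported along B. Both have symmetrization IᵀI, and the two pseudo-morphism equations together
say I G⁻¹ G' = I. It suffices to find D with I D = I and Dᵀ G D = G': then C = D⁻¹ works, and the
identity for the star is this congruence multiplied by G⁻¹.

Let the columns of K be a basis of ker I. Then G' - G = G (K A Kᵀ) Gᵀ with A skew, and the ansatz D
= 1 + K P Kᵀ Gᵀ turns the problem into A = P - Pᵀ + Pᵀ H P, where H = Kᵀ G K is skew. For H = J ⊕ 0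
this is solvable over ℤ: completing the square reduces it to the congruence of a unimodular skew
matrix with J (`exists_eq_sub_transpose_add`).

The crux is that H has only 0 and units as elementary divisors (`exists_darboux_matrix`). The reason
is combinatorial: descending walks permute the vertices, so I(R†) I(R)ᵀ is 1 minus a permutation
matrix. A vector that is invariant under a permutation modulo N has entrywise residues that are
exactly invariant, and this lifts a congruence modulo N to a true element of the radical. -/

/-! ### Alternating forms over a principal ideal domain -/

/-- An alternating bilinear form on a finite free module over a principal ideal domain, all of
whose elementary divisors are `0` or units, is the orthogonal sum of hyperbolic planes and a zero
form. -/
theorem exists_darboux_equiv {R : Type} [CommRing R] [IsDomain R] [IsPrincipalIdealRing R]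
    (r : ℕ) : ∀ (K : Type) [AddCommGroup K] [Module R K] [Module.Free R K] [Module.Finite R K]
    (J : LinearMap.BilinForm R K),
    Module.finrank R K = r → (∀ x, J x x = 0) →
    (∀ (N : R) (k : K), N ≠ 0 → (∀ k', N ∣ J k k') →
      ∃ k₀ k₁ : K, (∀ k', J k₀ k' = 0) ∧ k = k₀ + N • k₁) →
    ∃ (g z : ℕ) (e : K ≃ₗ[R] (Fin g → R) × (Fin g → R) × (Fin z → R)),
      ∀ x y, J x y = (e x).2.1 ⬝ᵥ (e y).1 - (e x).1 ⬝ᵥ (e y).2.1 := by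
  induction r using Nat.strong_induction_on with
  | _ r ih =>
  intro K _ _ _ _ J hr halt hdiv
  have hskew : ∀ x y, J x y = -J y x := by
    intro x y
    have := halt (x + y)
    simp only [map_add, LinearMap.add_apply, halt] at this
    linear_combination this
  by_cases h0 : ∀ x y, J x y = 0
  · let e₁ : K ≃ₗ[R] (Fin (Module.finrank R K) → R) := (Module.finBasis R K).equivFun
    refine ⟨0, Module.finrank R K,
      { toFun := fun x => (0, 0, e₁ x)
        map_add' := fun x y => by simp
        map_smul' := fun a x => by simp
        invFun := fun p => e₁.symm p.2.2
        left_inv := fun x => by simp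
        right_inv := fun p => by
          refine Prod.ext (Subsingleton.elim _ _) (Prod.ext (Subsingleton.elim _ _) ?_)
          simp }, fun x y => by simp [h0]⟩
  · push Not at h0
    obtain ⟨x, y', hxy'⟩ := h0
    -- The values of `J x` form an ideal (N). The divisibility hypothesis divides `x` by N modulo
    -- the radical, which gives a `v` that pairs to 1 with some `w`.
    obtain ⟨N, hN⟩ := (IsPrincipalIdealRing.principal (LinearMap.range (J x))).principal
    have hmem : ∀ a, a ∈ LinearMap.range (J x) ↔ N ∣ a := by
      intro a
      rw [hN]
      exact Ideal.mem_span_singleton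
    have hN0 : N ≠ 0 := by
      rintro rfl
      exact hxy' (zero_dvd_iff.1 ((hmem _).1 ⟨y', rfl⟩))
    obtain ⟨k₀, v, hk₀, hx⟩ := hdiv N x hN0 fun k' => (hmem _).1 ⟨k', rfl⟩
    obtain ⟨w, hw⟩ := (hmem N).2 dvd_rfl
    have hvw : J v w = 1 := by
      rw [hx] at hw
      simp only [map_add, LinearMap.add_apply, hk₀, map_smul, LinearMap.smul_apply, smul_eq_mul,
        zero_add] at hw
      exact mul_left_cancel₀ hN0 (hw.trans (mul_one N).symm)
    have hwv : J w v = -1 := by rw [hskew, hvw]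
    -- The plane spanned by `v` and `w` is unimodular, so it splits off with orthogonal complement
    -- `L`.
    let L : Submodule R K := LinearMap.ker (J v) ⊓ LinearMap.ker (J w)
    have hL1 : ∀ l : L, J v l = 0 := fun l => l.2.1
    have hL2 : ∀ l : L, J w l = 0 := fun l => l.2.2
    let E : K ≃ₗ[R] R × R × L :=
      { toFun := fun x => (J w x, J v x, ⟨x - J v x • w + J w x • v, by
          constructor
          · show J v _ = 0
            simp [hvw, halt]
          · show J w _ = 0
            simp [hwv, halt]⟩)
        map_add' := fun x y => by
          refine Prod.ext (by simp) (Prod.ext (by simp) (Subtype.ext ?_))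
          simp only [map_add, add_smul, Prod.snd_add, Submodule.coe_add]
          module
        map_smul' := fun a x => by
          refine Prod.ext (by simp) (Prod.ext (by simp) (Subtype.ext ?_))
          simp only [map_smul, smul_eq_mul, RingHom.id_apply, Prod.smul_snd, Submodule.coe_smul]
          module
        invFun := fun p => p.2.1 • w - p.1 • v + (p.2.2 : K)
        left_inv := fun x => by simp
        right_inv := fun p => by
          refine Prod.ext ?_ (Prod.ext ?_ (Subtype.ext ?_))
          · simp [hwv, halt, hL2]
          · simp [hvw, halt, hL1]
          · simp only [map_add, map_sub, map_smul, smul_eq_mul, hwv, hvw, halt, hL1, hL2]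
            module }
    have hE : ∀ x, x = (E x).2.1 • w - (E x).1 • v + ((E x).2.2 : K) := fun x =>
      (E.symm_apply_apply x).symm
    have hrk : Module.finrank R L < r := by
      have := E.finrank_eq
      simp only [Module.finrank_prod, Module.finrank_self] at this
      omega
    have hrestr : ∀ (l : L) (x : K), J l x = J l (E x).2.2 := by
      intro l x
      have h1 : J l w = 0 := by rw [hskew, hL2, neg_zero]
      have h2 : J l v = 0 := by rw [hskew, hL1, neg_zero]
      conv_lhs => rw [hE x]
      simp [h1, h2]
    obtain ⟨g, z, e, he⟩ := ih _ hrk L (J.restrict L) rfl (fun x => halt x) (by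
      intro N k hN hk
      obtain ⟨k₀, k₁, hk₀, hk⟩ := hdiv N (k : K) hN fun k' => by
        rw [hrestr]
        exact hk (E k').2.2
      have m0 : k₀ ∈ L := by
        constructor
        · show J v k₀ = 0
          rw [hskew, hk₀, neg_zero]
        · show J w k₀ = 0
          rw [hskew, hk₀, neg_zero]
      -- The divisibility hypothesis descends to `L`: the pairings with `v` and `w` vanish on `N •
      -- k₁`, and N cancels.
      have m1 : k₁ ∈ L := by
        have : N • k₁ ∈ L := by
          rw [← add_sub_cancel_left k₀ (N • k₁), ← hk]
          exact L.sub_mem k.2 m0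
        constructor
        · have h : J v (N • k₁) = 0 := this.1
          rw [LinearMap.map_smul, smul_eq_mul] at h
          exact (mul_eq_zero.1 h).resolve_left hN
        · have h : J w (N • k₁) = 0 := this.2
          rw [LinearMap.map_smul, smul_eq_mul] at h
          exact (mul_eq_zero.1 h).resolve_left hN
      exact ⟨⟨k₀, m0⟩, ⟨k₁, m1⟩, fun k' => hk₀ k', Subtype.ext hk⟩)
    let F : (R × R × ((Fin g → R) × (Fin g → R) × (Fin z → R))) ≃ₗ[R]
        (Fin (g + 1) → R) × (Fin (g + 1) → R) × (Fin z → R) :=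
      { toFun := fun p => (Matrix.vecCons p.1 p.2.2.1, Matrix.vecCons p.2.1 p.2.2.2.1, p.2.2.2.2)
        map_add' := fun p q => by simp
        map_smul' := fun a p => by simp
        invFun := fun q => (q.1 0, q.2.1 0, Matrix.vecTail q.1, Matrix.vecTail q.2.1, q.2.2)
        left_inv := fun p => by simp
        right_inv := fun q => by
          refine Prod.ext (Matrix.cons_head_tail _) (Prod.ext (Matrix.cons_head_tail _) rfl) }
    refine ⟨g + 1, z, (E.trans ((LinearEquiv.refl R R).prodCongr
      ((LinearEquiv.refl R R).prodCongr e))).trans F, fun x y => ?_⟩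
    have h1 : J x y = (E x).2.1 * (E y).1 - (E x).1 * (E y).2.1 + J (E x).2.2 (E y).2.2 := by
      have h1 : J (E x).2.2 w = 0 := by rw [hskew, hL2, neg_zero]
      have h2 : J (E x).2.2 v = 0 := by rw [hskew, hL1, neg_zero]
      conv_lhs => rw [hE x, hE y]
      simp only [map_add, map_sub, map_smul, LinearMap.add_apply, LinearMap.sub_apply,
        LinearMap.smul_apply, smul_eq_mul, hwv, hvw, halt, hL1, hL2, h1, h2]
      ring
    have h2 : J (E x).2.2 (E y).2.2 = _ := he (E x).2.2 (E y).2.2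
    rw [h1, h2]
    simp only [LinearEquiv.trans_apply, LinearEquiv.prodCongr_apply, LinearEquiv.refl_apply, F,
      LinearEquiv.coe_mk, LinearMap.coe_mk, AddHom.coe_mk, Matrix.cons_dotProduct_cons]
    ring

/-- An alternating bilinear form on a finite free module over a principal ideal domain, all of
whose elementary divisors are `0` or units, has the Gram matrix `J ⊕ 0` in some basis. -/
theorem exists_darboux_basis {R K : Type} [CommRing R] [IsDomain R] [IsPrincipalIdealRing R]
    [AddCommGroup K] [Module R K] [Module.Free R K] [Module.Finite R K]
    (J : LinearMap.BilinForm R K) (halt : ∀ x, J x x = 0)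
    (hdiv : ∀ (N : R) (k : K), N ≠ 0 → (∀ k', N ∣ J k k') →
      ∃ k₀ k₁ : K, (∀ k', J k₀ k' = 0) ∧ k = k₀ + N • k₁) :
    ∃ (g z : ℕ) (b : Module.Basis ((Fin g ⊕ Fin g) ⊕ Fin z) R K),
      ∀ i j, J (b i) (b j) = Matrix.fromBlocks (Matrix.J (Fin g) R) 0 0 0 i j := by
  obtain ⟨g, z, e, he⟩ := exists_darboux_equiv _ K J rfl halt hdiv
  let F : ((Fin g → R) × (Fin g → R) × (Fin z → R)) ≃ₗ[R] ((Fin g ⊕ Fin g) ⊕ Fin z → R) :=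
    { toFun := fun p => Sum.elim (Sum.elim p.1 p.2.1) p.2.2
      map_add' := fun p q => by ext ((i | i) | i) <;> rfl
      map_smul' := fun a p => by ext ((i | i) | i) <;> rfl
      invFun := fun f => (fun i => f (.inl (.inl i)), fun i => f (.inl (.inr i)), fun i => f (.inr i))
      left_inv := fun p => rfl
      right_inv := fun f => by ext ((i | i) | i) <;> rfl }
  refine ⟨g, z, Module.Basis.ofEquivFun (e.trans F), fun i j => ?_⟩
  have hb : ∀ i, e (Module.Basis.ofEquivFun (e.trans F) i) = F.symm (Pi.single i 1) := fun i => by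
    simp [Module.Basis.coe_ofEquivFun]
  have h1 : ∀ i, (F.symm (Pi.single i 1)).1 = fun a => (Pi.single i 1 : _ → R) (.inl (.inl a)) :=
    fun i => rfl
  have h2 : ∀ i, (F.symm (Pi.single i 1)).2.1 = fun a => (Pi.single i 1 : _ → R) (.inl (.inr a)) :=
    fun i => rfl
  rw [he, hb, hb, h1, h1, h2, h2]
  rcases i with (i | i) | i <;> rcases j with (j | j) | j <;>
    simp [dotProduct, Pi.single_apply, Matrix.J, Matrix.one_apply, eq_comm]

/-- A unimodular skew-symmetric integral matrix is congruent to `J`. -/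
theorem exists_congr_J {g : ℕ} (M : Matrix (Fin g ⊕ Fin g) (Fin g ⊕ Fin g) ℤ)
    (hM : M.transpose = -M) (hu : IsUnit M) :
    ∃ U : Matrix (Fin g ⊕ Fin g) (Fin g ⊕ Fin g) ℤ,
      U.transpose * M * U = Matrix.J (Fin g) ℤ := by
  have hdet : IsUnit M.det := (Matrix.isUnit_iff_isUnit_det M).1 hu
  have hinv : ∀ k : Fin g ⊕ Fin g → ℤ, k = Matrix.vecMul (Matrix.vecMul k M) M⁻¹ := fun k => by
    rw [Matrix.vecMul_vecMul, Matrix.mul_nonsing_inv _ hdet, Matrix.vecMul_one]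
  have hB : ∀ x y, Matrix.toBilin' M x y = Matrix.vecMul x M ⬝ᵥ y := fun x y => by
    rw [Matrix.toBilin'_apply', Matrix.dotProduct_mulVec]
  obtain ⟨g', z, b, hb⟩ := exists_darboux_basis (Matrix.toBilin' M)
    (fun x => by
      have h : x ⬝ᵥ M.mulVec x = -(x ⬝ᵥ M.mulVec x) := by
        conv_lhs => rw [Matrix.dotProduct_mulVec, dotProduct_comm, ← Matrix.mulVec_transpose, hM,
          Matrix.neg_mulVec, dotProduct_neg]
      rw [Matrix.toBilin'_apply']
      linarith)
    -- Unimodularity allows the radical part to be 0: if N divides kᵀM, then k itself is N times an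
    -- integral vector.
    (fun N k _ h => by
      have h' : ∀ i, N ∣ Matrix.vecMul k M i := fun i => by
        have := h (Pi.single i 1)
        rwa [hB, dotProduct_single, mul_one] at this
      choose l hl using h'
      refine ⟨0, Matrix.vecMul l M⁻¹, fun k' => by simp, ?_⟩
      have : Matrix.vecMul k M = N • l := funext hl
      rw [zero_add, ← Matrix.smul_vecMul, ← this]
      exact hinv k)
  -- A basis vector in the zero summand would lie in the radical, which is trivial for unimodular
  -- `M`.
  have hz : z = 0 := by
    by_contra hz
    let c : (Fin g' ⊕ Fin g') ⊕ Fin z := .inr ⟨0, Nat.pos_of_ne_zero hz⟩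
    have h0 : Matrix.toBilin' M (b c) = 0 := b.ext fun j => by rw [hb]; rcases j with j | j <;> rfl
    refine b.ne_zero c ((hinv _).trans ?_)
    have : Matrix.vecMul (b c) M = 0 := by
      ext i
      have := congrArg (fun f => f (Pi.single i 1)) h0
      simpa [hB] using this
    rw [this, Matrix.zero_vecMul]
  subst hz
  have hg : g' = g := by
    have := Module.finrank_eq_card_basis b
    simp at this
    omega
  subst hg
  refine ⟨Matrix.of fun i j => b (.inl j) i, ?_⟩
  ext i j
  have := hb (.inl i) (.inl j)
  rw [Matrix.fromBlocks_apply₁₁] at this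
  rw [← this, Matrix.toBilin'_apply', Matrix.mul_assoc]
  rfl

/-! ### The quadratic matrix equation and the congruence -/

/-- A skew-symmetric integral matrix is the difference of a matrix and its transpose. -/
theorem exists_eq_sub_transpose {z : ℕ} (A : Matrix (Fin z) (Fin z) ℤ) (hA : A.transpose = -A) :
    ∃ P : Matrix (Fin z) (Fin z) ℤ, A = P - P.transpose := by
  refine ⟨Matrix.of fun i j => if i < j then A i j else 0, ?_⟩
  ext i j
  have h : A j i = -A i j := congrFun (congrFun hA i) j
  rcases lt_trichotomy i j with hij | rfl | hij
  · simp [hij, hij.not_gt]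
  · simp only [Matrix.sub_apply, Matrix.transpose_apply, sub_self]
    omega
  · simp [hij, hij.not_gt, h]

open Matrix in
/-- The matrix equation that describes the congruences between two bilinear forms with the same
symmetrization is solvable over the integers. -/
theorem exists_eq_sub_transpose_add {g z : ℕ}
    (A : Matrix ((Fin g ⊕ Fin g) ⊕ Fin z) ((Fin g ⊕ Fin g) ⊕ Fin z) ℤ) (hA : Aᵀ = -A)
    (hu : IsUnit (1 - A * fromBlocks (J (Fin g) ℤ) 0 0 0)) :
    ∃ P : Matrix ((Fin g ⊕ Fin g) ⊕ Fin z) ((Fin g ⊕ Fin g) ⊕ Fin z) ℤ,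
      A = P - Pᵀ + Pᵀ * fromBlocks (J (Fin g) ℤ) 0 0 0 * P := by
  obtain ⟨A₁, A₂, A₃, A₄, rfl⟩ : ∃ A₁ A₂ A₃ A₄, A = fromBlocks A₁ A₂ A₃ A₄ :=
    ⟨_, _, _, _, (fromBlocks_toBlocks A).symm⟩
  rw [fromBlocks_transpose, fromBlocks_neg, fromBlocks_inj] at hA
  obtain ⟨h1, h2, -, h4⟩ := hA
  have hJ := J_squared (Fin g) ℤ
  have hJt := J_transpose (Fin g) ℤ
  -- Since J² = -1, the J-block of the hypothesis is 1 - A₁J = -(A₁ + J)J, and the whole matrix is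
  -- block triangular.
  have hM : IsUnit (A₁ + J (Fin g) ℤ) := by
    rw [isUnit_iff_isUnit_det] at hu ⊢
    have h : 1 - fromBlocks A₁ A₂ A₃ A₄ * fromBlocks (J (Fin g) ℤ) 0 0 0 =
        fromBlocks (-((A₁ + J (Fin g) ℤ) * J (Fin g) ℤ)) 0 (-(A₃ * J (Fin g) ℤ)) 1 := by
      rw [fromBlocks_multiply, ← fromBlocks_one, sub_eq_add_neg, fromBlocks_neg, fromBlocks_add,
        add_mul, hJ]
      congr 1 <;> simp
    rw [h, det_fromBlocks_zero₁₂, det_one, mul_one, ← Matrix.mul_neg, det_mul] at hu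
    exact isUnit_of_mul_isUnit_left hu
  obtain ⟨U, hU⟩ := exists_congr_J (A₁ + J (Fin g) ℤ)
    (by rw [transpose_add, h1, hJt, neg_add]) hM
  have hUd : IsUnit U.det := by
    have := isUnit_det_J (Fin g) ℤ
    rw [← hU, det_mul] at this
    exact isUnit_of_mul_isUnit_right this
  have hUt : IsUnit Uᵀ.det := by rwa [det_transpose]
  have hW : (U⁻¹)ᵀ * J (Fin g) ℤ * U⁻¹ = A₁ + J (Fin g) ℤ := by
    calc (U⁻¹)ᵀ * J (Fin g) ℤ * U⁻¹ = (U⁻¹)ᵀ * (Uᵀ * (A₁ + J (Fin g) ℤ) * U) * U⁻¹ := by rw [hU]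
      _ = A₁ + J (Fin g) ℤ := by
        rw [transpose_nonsing_inv, Matrix.mul_assoc Uᵀ, nonsing_inv_mul_cancel_left _ _ hUt,
          mul_nonsing_inv_cancel_right _ _ hUd]
  generalize U⁻¹ = W at hW
  obtain ⟨P₄, hP₄⟩ := exists_eq_sub_transpose A₄ h4
  -- Completing the square: the first block of the equation says (P₁ + J)ᵀ J (P₁ + J) = A₁ + J,
  -- hence P₁ = W - J. The other blocks are linear once the upper right block of P is 0.
  refine ⟨fromBlocks (W - J (Fin g) ℤ) 0 A₃ P₄, ?_⟩
  rw [fromBlocks_transpose, fromBlocks_multiply, fromBlocks_multiply, sub_eq_add_neg,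
    fromBlocks_neg, fromBlocks_add, fromBlocks_add, fromBlocks_inj]
  refine ⟨?_, ?_, ?_, ?_⟩
  · simp only [transpose_sub, hJt, Matrix.sub_mul, Matrix.mul_sub, hW, Matrix.mul_zero,
      Matrix.zero_mul, add_zero, Matrix.neg_mul, Matrix.mul_neg, Matrix.mul_assoc Wᵀ, hJ,
      Matrix.mul_one, Matrix.one_mul]
    abel
  · simp [h2]
  · simp
  · simpa [sub_eq_add_neg] using hP₄

open Matrix in
/-- Two bilinear forms with the same symmetrization `IᵀI`, of which the first one has the Gram
matrix `J ⊕ 0` on the kernel of `I`, are congruent under a matrix that preserves `I`, provided that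
the second form agrees with the first one in the sense that `I G⁻¹ G' = I`. -/
theorem exists_congr_of_darboux {m n g z : ℕ} {I : Matrix (Fin m) (Fin n) ℤ}
    {G G' : Matrix (Fin n) (Fin n) ℤ} {K : Matrix (Fin n) ((Fin g ⊕ Fin g) ⊕ Fin z) ℤ}
    (hG : G + Gᵀ = Iᵀ * I) (hG' : G' + G'ᵀ = Iᵀ * I) (hu : IsUnit G) (hu' : IsUnit G')
    (hI : I * G⁻¹ * G' = I) (hIK : I * K = 0)
    (hK : ∀ x, I.mulVec x = 0 → ∃ c, x = K.mulVec c) (hinj : ∀ c, K.mulVec c = 0 → c = 0)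
    (hJ : Kᵀ * G * K = fromBlocks (J (Fin g) ℤ) 0 0 0) :
    ∃ D : Matrix (Fin n) (Fin n) ℤ, I * D = I ∧ Dᵀ * G * D = G' := by
  have hfac : ∀ {ι : Type} (M : Matrix (Fin n) ι ℤ), I * M = 0 →
      ∃ X : Matrix ((Fin g ⊕ Fin g) ⊕ Fin z) ι ℤ, M = K * X := by
    intro ι M hM
    have h : ∀ j, ∃ c, M.col j = K.mulVec c := fun j => hK _ (by
      ext i
      exact congrFun (congrFun hM i) j)
    choose c hc using h
    exact ⟨Matrix.of fun a j => c j a, by ext i j; exact congrFun (hc j) i⟩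
  have hcan : ∀ {ι : Type} (X : Matrix ((Fin g ⊕ Fin g) ⊕ Fin z) ι ℤ), K * X = 0 → X = 0 := by
    intro ι X hX
    ext a j
    exact congrFun (hinj (X.col j) (by ext i; exact congrFun (congrFun hX i) j)) a
  have hd : IsUnit G.det := (isUnit_iff_isUnit_det G).1 hu
  have hdt : IsUnit Gᵀ.det := by rwa [det_transpose]
  -- The normalized difference of the two forms: it is skew and killed by I on the left, hence by Iᵀ
  -- on the right, so it has the form K A Kᵀ.
  obtain ⟨T, hT⟩ : ∃ T, T = G⁻¹ * (G' - G) * Gᵀ⁻¹ := ⟨_, rfl⟩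
  have hTG : G * T * Gᵀ = G' - G := by
    rw [hT, Matrix.mul_assoc G⁻¹, mul_nonsing_inv_cancel_left _ _ hd,
      nonsing_inv_mul_cancel_right _ _ hdt]
  have hTt : Tᵀ = -T := by
    have h : (G' - G)ᵀ = -(G' - G) := by
      rw [transpose_sub, eq_sub_of_add_eq' hG, eq_sub_of_add_eq' hG']
      abel
    rw [hT, transpose_mul, transpose_mul, h, transpose_nonsing_inv, transpose_nonsing_inv,
      transpose_transpose, Matrix.neg_mul, Matrix.mul_neg, Matrix.mul_assoc]
  have hIT : I * T = 0 := by
    rw [hT, ← Matrix.mul_assoc, ← Matrix.mul_assoc, Matrix.mul_sub, hI,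
      nonsing_inv_mul_cancel_right _ _ hd, sub_self, Matrix.zero_mul]
  obtain ⟨X, hX⟩ := hfac T hIT
  have hIX : I * Xᵀ = 0 := by
    rw [← transpose_eq_zero]
    refine hcan _ ?_
    rw [transpose_mul, transpose_transpose, ← Matrix.mul_assoc, ← hX,
      ← transpose_eq_zero, transpose_mul, hTt, transpose_transpose, Matrix.mul_neg, hIT, neg_zero]
  obtain ⟨A', hA'⟩ := hfac Xᵀ hIX
  obtain ⟨A, hA⟩ : ∃ A, A = A'ᵀ := ⟨_, rfl⟩
  have hTA : T = K * A * Kᵀ := by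
    rw [hX, Matrix.mul_assoc, hA, ← transpose_mul, ← hA', transpose_transpose]
  have hAt : Aᵀ = -A := by
    have h : K * ((Aᵀ + A) * Kᵀ) = 0 := by
      have : Tᵀ + T = 0 := by rw [hTt, neg_add_cancel]
      rw [← this, hTA, transpose_mul, transpose_mul, transpose_transpose]
      simp only [Matrix.add_mul, Matrix.mul_add, Matrix.mul_assoc]
    have h2 := congrArg transpose (hcan _ h)
    rw [transpose_mul, transpose_transpose, transpose_zero] at h2
    exact eq_neg_of_add_eq_zero_left (transpose_eq_zero.1 (hcan _ h2))
  have hKG : Kᵀ * G = -(Kᵀ * Gᵀ) := by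
    have : Kᵀ * (G + Gᵀ) = 0 := by
      rw [hG, ← Matrix.mul_assoc, ← transpose_mul, hIK, transpose_zero, Matrix.zero_mul]
    rw [Matrix.mul_add] at this
    exact eq_neg_of_add_eq_zero_left this
  have hJ' : Kᵀ * Gᵀ * K = -fromBlocks (J (Fin g) ℤ) 0 0 0 := by
    rw [← hJ, hKG, Matrix.neg_mul, neg_neg]
  -- G' = G (1 + K A Kᵀ Gᵀ) is unimodular; det(1 + XY) = det(1 + YX) moves this to the smaller
  -- matrix.
  have hAu : IsUnit (1 - A * fromBlocks (J (Fin g) ℤ) 0 0 0) := by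
    have h1 : G' = G * (1 + K * (A * Kᵀ * Gᵀ)) := by
      rw [Matrix.mul_add, Matrix.mul_one, ← Matrix.mul_assoc K, ← Matrix.mul_assoc K, ← hTA,
        ← Matrix.mul_assoc, hTG, add_sub_cancel]
    rw [isUnit_iff_isUnit_det, h1, det_mul, det_one_add_mul_comm, Matrix.mul_assoc A,
      Matrix.mul_assoc A, hJ', Matrix.mul_neg, ← sub_eq_add_neg] at hu'
    exact (isUnit_iff_isUnit_det _).2 (isUnit_of_mul_isUnit_right hu')
  obtain ⟨P, hP⟩ := exists_eq_sub_transpose_add A hAt hAu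
  -- I K = 0 makes this fix I. As Kᵀ G = -Kᵀ Gᵀ, expanding Dᵀ G D gives G + G K (P - Pᵀ + Pᵀ H P) Kᵀ
  -- Gᵀ.
  refine ⟨1 + K * P * Kᵀ * Gᵀ, ?_, ?_⟩
  · simp only [Matrix.mul_add, ← Matrix.mul_assoc, hIK, Matrix.zero_mul, Matrix.mul_one, add_zero]
  · have h1 : (1 + K * P * Kᵀ * Gᵀ)ᵀ * G = G - G * K * Pᵀ * (Kᵀ * Gᵀ) := by
      simp only [transpose_add, transpose_mul, transpose_transpose, transpose_one, Matrix.add_mul,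
        Matrix.one_mul]
      rw [sub_eq_add_neg, ← Matrix.mul_neg, ← hKG]
      simp only [Matrix.mul_assoc]
    have h2 : G' = G + G * K * A * (Kᵀ * Gᵀ) := by
      rw [← sub_eq_iff_eq_add', ← hTG, hTA]
      simp only [Matrix.mul_assoc]
    have h3 : G * K * Pᵀ * (Kᵀ * Gᵀ) * (K * P * Kᵀ * Gᵀ) =
        -(G * K * (Pᵀ * fromBlocks (J (Fin g) ℤ) 0 0 0 * P) * (Kᵀ * Gᵀ)) := by
      calc _ = G * K * Pᵀ * (Kᵀ * Gᵀ * K) * P * (Kᵀ * Gᵀ) := by simp only [Matrix.mul_assoc]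
        _ = _ := by
          rw [hJ']
          simp only [Matrix.mul_neg, Matrix.neg_mul, Matrix.mul_assoc]
    have h4 : G * (K * P * Kᵀ * Gᵀ) = G * K * P * (Kᵀ * Gᵀ) := by simp only [Matrix.mul_assoc]
    rw [h1, h2, Matrix.mul_add, Matrix.mul_one, Matrix.sub_mul, h3, h4]
    rw [hP]
    simp only [Matrix.mul_add, Matrix.mul_sub, Matrix.add_mul, Matrix.sub_mul]
    abel

/-! ### The form on the kernel of the incidence matrix -/

namespace FinQuiver

variable {m n : ℕ}

open Matrix

theorem inc_mulVec_single (Q : FinQuiver m n) (i : Fin n) :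
    Q.inc.mulVec (Pi.single i 1) = Pi.single (Q.src i) 1 - Pi.single (Q.tgt i) 1 := by
  rw [mulVec_single_one]
  rfl

/-- The incidence matrix of a connected quiver has an integral generalized inverse. -/
theorem Connected.exists_generalized_inverse {Q : FinQuiver m n} (hQ : Q.Connected) :
    ∃ T : Matrix (Fin n) (Fin m) ℤ, Q.inc * T * Q.inc = Q.inc := by
  obtain ⟨v₀⟩ := hQ.nonempty
  -- Signed sums of arrows along a path from `v₀`; these vectors become the columns of the
  -- generalized inverse.
  have h : ∀ v, ∃ x, Q.inc.mulVec x = Pi.single v 1 - Pi.single v₀ 1 := by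
    intro v
    have hr := (SimpleGraph.reachable_iff_reflTransGen _ _).1 (hQ.preconnected v₀ v)
    induction hr with
    | refl => exact ⟨0, by simp⟩
    | tail _ hadj ih =>
      obtain ⟨x, hx⟩ := ih
      obtain ⟨-, ⟨i, rfl, rfl⟩ | ⟨i, rfl, rfl⟩⟩ := (SimpleGraph.fromRel_adj _ _ _).1 hadj
      · exact ⟨x - Pi.single i 1, by rw [mulVec_sub, hx, inc_mulVec_single]; abel⟩
      · exact ⟨x + Pi.single i 1, by rw [mulVec_add, hx, inc_mulVec_single]; abel⟩
  choose x hx using h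
  refine ⟨Matrix.of fun i v => x v i, ?_⟩
  refine Matrix.ext_of_mulVec_single fun i => ?_
  have hT : ∀ v, (Matrix.of fun i v => x v i).mulVec (Pi.single v 1) = x v := fun v => by
    rw [mulVec_single_one]
    rfl
  rw [← mulVec_mulVec, ← mulVec_mulVec, inc_mulVec_single, mulVec_sub, hT, hT, mulVec_sub, hx, hx]
  abel

/-- Each arrow contributes the transposition of its end points. -/
theorem exists_perm_eq_descend (Q : FinQuiver m n) (k : ℕ) :
    ∃ σ : Equiv.Perm (Fin m), ∀ v, Q.descend k v = σ v := by
  induction k with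
  | zero => exact ⟨1, fun v => rfl⟩
  | succ k ih =>
    obtain ⟨σ, hσ⟩ := ih
    by_cases h : k < n
    · exact ⟨σ * Equiv.swap (Q.src ⟨k, h⟩) (Q.tgt ⟨k, h⟩), fun v => by simp [descend, h, hσ]⟩
    · exact ⟨σ, fun v => by simp [descend, h, hσ]⟩

/-- `I(Q†) I(Q)ᵀ` is the difference of the identity and a permutation matrix. -/
theorem exists_perm_dagger_inc_mul_transpose (Q : FinQuiver m n) :
    ∃ σ : Equiv.Perm (Fin m), ∀ (y : Fin m → ℤ) w,
      (Q.dagger.inc * Q.incᵀ).mulVec y w = y w - y (σ w) := by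
  obtain ⟨σ, hσ⟩ := Q.exists_perm_eq_descend n
  -- Column v of the product is e_v - e_{σ v}; reading it by rows inverts σ.
  refine ⟨σ.symm, fun y w => ?_⟩
  have h : ∀ v, (Q.dagger.inc * Q.incᵀ) w v =
      (Pi.single v 1 : Fin m → ℤ) w - (Pi.single (σ v) 1 : Fin m → ℤ) w := by
    intro v
    have := Q.single_descend w n v
    simp only [Fin.is_lt, if_true] at this
    rw [← hσ, this, mul_apply]
    simp
  simp only [mulVec, dotProduct, h, Pi.single_apply, sub_mul, Finset.sum_sub_distrib, ite_mul,
    one_mul, zero_mul, Finset.sum_ite_eq, Finset.mem_univ, if_true, ← Equiv.symm_apply_eq]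

/-- The symmetrization IᵀI vanishes as soon as one argument is in ker I, so there the form is skew.
-/
theorem dotProduct_upperGram_mulVec_swap (Q : FinQuiver m n) {x : Fin n → ℤ}
    (hx : Q.inc.mulVec x = 0) (y : Fin n → ℤ) :
    x ⬝ᵥ Q.upperGram.mulVec y = -(y ⬝ᵥ Q.upperGram.mulVec x) := by
  have h : y ⬝ᵥ (Q.upperGram + Q.upperGramᵀ).mulVec x = 0 := by
    rw [upperGram_add_transpose, gram, ← mulVec_mulVec, hx, mulVec_zero, dotProduct_zero]
  rw [add_mulVec, dotProduct_add, mulVec_transpose, dotProduct_comm y (vecMul x _),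
    ← dotProduct_mulVec] at h
  linarith

/-- The upper triangular Gram matrix of a loop-less quiver whose incidence matrix has an integral
generalized inverse takes the shape `J ⊕ 0` in some basis of the kernel of the incidence matrix. -/
theorem exists_darboux_matrix {Q : FinQuiver m n} (hQ : Q.Loopless)
    {T : Matrix (Fin n) (Fin m) ℤ} (hT : Q.inc * T * Q.inc = Q.inc) :
    ∃ (g z : ℕ) (K : Matrix (Fin n) ((Fin g ⊕ Fin g) ⊕ Fin z) ℤ), Q.inc * K = 0 ∧
      (∀ x, Q.inc.mulVec x = 0 → ∃ c, x = K.mulVec c) ∧ (∀ c, K.mulVec c = 0 → c = 0) ∧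
      Kᵀ * Q.upperGram * K = fromBlocks (J (Fin g) ℤ) 0 0 0 := by
  have hd : IsUnit Q.upperGram.det := by rw [Q.det_upperGram hQ]; exact isUnit_one
  have hdag : ∀ x, Q.inc.mulVec (Q.upperGram⁻¹.mulVec x) = Q.dagger.inc.mulVec x := fun x => by
    rw [Q.inc_dagger hQ, mulVec_mulVec]
  have hinv : ∀ x, Q.upperGram⁻¹.mulVec (Q.upperGram.mulVec x) = x := fun x => by
    rw [mulVec_mulVec, nonsing_inv_mul _ hd, one_mulVec]
  have hinv' : ∀ x, Q.upperGram.mulVec (Q.upperGram⁻¹.mulVec x) = x := fun x => by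
    rw [mulVec_mulVec, mul_nonsing_inv _ hd, one_mulVec]
  obtain ⟨σ, hσ⟩ := Q.exists_perm_dagger_inc_mul_transpose
  let V : Submodule ℤ (Fin n → ℤ) := LinearMap.ker Q.inc.mulVecLin
  have hV : ∀ x, x ∈ V ↔ Q.inc.mulVec x = 0 := fun x => Iff.rfl
  have hform : ∀ x y : V, (toBilin' Q.upperGram).restrict V x y =
      (x : Fin n → ℤ) ⬝ᵥ Q.upperGram.mulVec y := fun x y =>
    toBilin'_apply' Q.upperGram x y
  obtain ⟨g, z, b, hb⟩ := exists_darboux_basis ((toBilin' Q.upperGram).restrict V)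
    (fun x => by
      have := Q.dotProduct_upperGram_mulVec_swap x.2 x
      rw [hform]
      linarith)
    (fun N k hN hk => by
      have hk0 := (hV _).1 k.2
      let c : Fin n → ℤ := Q.upperGram.mulVec k
      let y : Fin m → ℤ := vecMul c T
      -- 1 - T I maps into ker I, where the functional `c` is divisible by N; the rest of `c` is in
      -- the row space, so c = N u + Iᵀ y.
      have hu : ∀ j, N ∣ (c - vecMul y Q.inc) j := by
        intro j
        have hj : (1 - T * Q.inc).mulVec (Pi.single j 1) ∈ V := by
          rw [hV, mulVec_mulVec, Matrix.mul_sub, Matrix.mul_one, ← Matrix.mul_assoc, hT, sub_self,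
            zero_mulVec]
        have h := hk ⟨_, hj⟩
        rw [hform, Q.dotProduct_upperGram_mulVec_swap hk0, dvd_neg, dotProduct_comm,
          dotProduct_mulVec, dotProduct_single, mul_one, vecMul_sub, vecMul_one,
          ← vecMul_vecMul] at h
        exact h
      choose u hu using hu
      have hc : Q.upperGram.mulVec k = N • u + Q.incᵀ.mulVec y := by
        rw [mulVec_transpose, ← sub_eq_iff_eq_add]
        exact funext hu
      -- Applying I G⁻¹ = I(Q†) to c = G k gives 0, since k is in ker I; the Iᵀ y term contributes y
      -- minus its permutation.
      have hy : ∀ w, N ∣ y w - y (σ w) := by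
        intro w
        have h : Q.dagger.inc.mulVec (Q.upperGram.mulVec k) w = 0 := by
          rw [← hdag, hinv, hk0]
          rfl
        rw [hc, mulVec_add, mulVec_mulVec, Pi.add_apply, hσ, mulVec_smul] at h
        refine ⟨-(Q.dagger.inc.mulVec u w), ?_⟩
        simp only [Pi.smul_apply, smul_eq_mul] at h
        linarith
      -- Residues modulo N are equal, not only congruent, along the orbits of σ. Thus I(Q†) Iᵀ y₀ =
      -- 0, and G⁻¹ Iᵀ y₀ lies in ker I.
      let y₀ : Fin m → ℤ := fun w => y w % N
      let y₁ : Fin m → ℤ := fun w => y w / N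
      have hy01 : y = y₀ + N • y₁ := funext fun w => (Int.emod_add_mul_ediv (y w) N).symm
      have hx₀ : Q.upperGram⁻¹.mulVec (Q.incᵀ.mulVec y₀) ∈ V := by
        rw [hV, hdag, mulVec_mulVec]
        ext w
        rw [hσ]
        have : y w % N = y (σ w) % N :=
          Int.emod_eq_emod_iff_emod_sub_eq_zero.2 (Int.emod_eq_zero_of_dvd (hy w))
        simp [y₀, this]
      have hk01 : (k : Fin n → ℤ) = Q.upperGram⁻¹.mulVec (Q.incᵀ.mulVec y₀) +
          N • Q.upperGram⁻¹.mulVec (u + Q.incᵀ.mulVec y₁) := by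
        rw [← hinv k, hc, hy01, ← mulVec_smul, ← mulVec_add]
        congr 1
        rw [mulVec_add, mulVec_smul, smul_add]
        abel
      have hx₁ : Q.upperGram⁻¹.mulVec (u + Q.incᵀ.mulVec y₁) ∈ V := by
        have : N • Q.upperGram⁻¹.mulVec (u + Q.incᵀ.mulVec y₁) ∈ V := by
          rw [← add_sub_cancel_left (Q.upperGram⁻¹.mulVec (Q.incᵀ.mulVec y₀)) (N • _), ← hk01]
          exact V.sub_mem k.2 hx₀
        rw [hV, mulVec_smul] at this
        exact (smul_eq_zero.1 this).resolve_left hN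
      -- G maps the first summand to Iᵀ y₀, which is orthogonal to ker I; so it is in the radical.
      refine ⟨⟨_, hx₀⟩, ⟨_, hx₁⟩, fun k' => ?_, Subtype.ext hk01⟩
      rw [hform, Q.dotProduct_upperGram_mulVec_swap hx₀, hinv', dotProduct_mulVec,
        vecMul_transpose, (hV _).1 k'.2, zero_dotProduct, neg_zero])
  have hKc : ∀ c, (Matrix.of fun i a => (b a : Fin n → ℤ) i).mulVec c =
      ((∑ a, c a • b a : V) : Fin n → ℤ) := by
    intro c
    ext i
    simp [mulVec, dotProduct, mul_comm]
  refine ⟨g, z, Matrix.of fun i a => (b a : Fin n → ℤ) i, ?_, ?_, ?_, ?_⟩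
  · ext w a
    exact congrFun ((hV _).1 (b a).2) w
  · intro x hx
    refine ⟨b.repr ⟨x, hx⟩, ?_⟩
    rw [hKc, b.sum_repr]
  · intro c hc
    rw [hKc] at hc
    exact funext (Fintype.linearIndependent_iff.1 b.linearIndependent c (Subtype.ext hc))
  · ext a a'
    rw [← hb, hform, Matrix.mul_assoc]
    rfl

/-! ### Standard quivers have no loops -/

theorem sum_take_lt_sum_take_succ {m : ℕ} (π : m.Partition) {t : ℕ} (ht : t < π.parts.card) :
    ((π.parts.sort (· ≥ ·)).take t).sum < ((π.parts.sort (· ≥ ·)).take (t + 1)).sum := by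
  have hl : t < (π.parts.sort (· ≥ ·)).length := by rwa [Multiset.length_sort]
  have hpos : 0 < (π.parts.sort (· ≥ ·))[t] :=
    π.parts_pos ((Multiset.mem_sort _).1 (List.getElem_mem hl))
  rw [List.sum_take_succ _ _ hl]
  omega

/-- The bound on `t` leaves one more positive part, so the partial sum up to `t + 1` is below m and
the subtraction in `partVertex` is not truncated. -/
theorem partVertex_succ_ne (hm : 2 ≤ m) (π : m.Partition) {t : ℕ} (ht : t + 1 < π.parts.card) :
    partVertex hm π t ≠ partVertex hm π (t + 1) := by
  have h1 := sum_take_lt_sum_take_succ π (t := t) (by omega)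
  have h2 := sum_take_lt_sum_take_succ π ht
  have h3 : ((π.parts.sort (· ≥ ·)).take (t + 1 + 1)).sum ≤ m := by
    have hs : (π.parts.sort (· ≥ ·)).sum = m := by
      rw [← Multiset.sum_coe, Multiset.sort_eq, π.parts_sum]
    have := List.sum_take_add_sum_drop (π.parts.sort (· ≥ ·)) (t + 1 + 1)
    omega
  rw [ne_eq, partVertex, partVertex, Fin.mk.injEq]
  omega

theorem lastArrow_fst_ne_snd (hm : 2 ≤ m) (π : m.Partition) :
    (lastArrow hm π).1 ≠ (lastArrow hm π).2 := by
  have h0 : π.parts.card ≠ 0 := fun h => by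
    have := π.parts_sum
    rw [Multiset.card_eq_zero.1 h, Multiset.sum_zero] at this
    omega
  rw [lastArrow]
  split_ifs with h
  · simp only [ne_eq, Fin.mk.injEq]
    omega
  · obtain ⟨t, ht⟩ : ∃ t, π.parts.card = t + 2 := ⟨π.parts.card - 2, by omega⟩
    rw [show π.parts.card - 2 = t by omega, show π.parts.card - 1 = t + 1 by omega]
    exact partVertex_succ_ne hm π (by omega)

theorem IsStandard.loopless {R : FinQuiver m n} (hR : R.IsStandard) : R.Loopless := by
  obtain ⟨hm, π, d, rfl, rfl⟩ := hR
  intro a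
  show (standardArrow hm π a).1 ≠ (standardArrow hm π a).2
  rw [standardArrow]
  split_ifs
  · simp
  · exact partVertex_succ_ne hm π (by omega)
  · exact (lastArrow_fst_ne_snd hm π).symm
  · exact lastArrow_fst_ne_snd hm π

/-! ### Gram matrices of the quadratic forms -/

theorem form_apply (Q : FinQuiver m n) (x : Fin n → ℤ) :
    Q.form x = x ⬝ᵥ Q.upperGram.mulVec x := by
  have h : Q.inc.mulVec x ⬝ᵥ Q.inc.mulVec x = 2 * (x ⬝ᵥ Q.upperGram.mulVec x) := by
    rw [dotProduct_mulVec, ← mulVec_transpose, mulVec_mulVec, ← gram, ← upperGram_add_transpose,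
      add_mulVec, add_dotProduct, mulVec_transpose, ← dotProduct_mulVec,
      dotProduct_comm (Q.upperGram.mulVec x)]
    ring
  show (Q.inc.mulVec x ⬝ᵥ Q.inc.mulVec x) / 2 = _
  omega

theorem upperTriangularGram_form (Q : FinQuiver m n) :
    upperTriangularGram Q.form = Q.upperGram := by
  have h : ∀ i j, (Pi.single i 1 : Fin n → ℤ) ⬝ᵥ Q.upperGram.mulVec (Pi.single j 1) =
      Q.upperGram i j := fun i j => by simp
  ext i j
  rw [upperTriangularGram, of_apply]
  split_ifs with hij hij'
  · have h0 : Q.upperGram j i = 0 := by simp [upperGram, hij.not_gt, hij.ne']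
    simp only [QuadraticMap.polar, form_apply, mulVec_add, dotProduct_add, add_dotProduct, h, h0]
    ring
  · rw [form_apply, h, hij']
  · simp [upperGram, hij, hij']

theorem isUnitForm_form {Q : FinQuiver m n} (hQ : Q.Loopless) : IsUnitForm Q.form := by
  intro i
  have h := congrFun (congrFun Q.upperTriangularGram_form i) i
  simpa [upperTriangularGram, upperGram, gram_diag, hQ i] using h

end FinQuiver

/-! ### The strong Gram congruence -/

open Matrix in
theorem mainTheorem7 {m n : ℕ} (Q R : FinQuiver m n)
    (hconn : Q.Connected) (hloop : Q.Loopless) (hR : R.IsStandard)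
    (B : Matrix (Fin n) (Fin n) ℤ) (hunit : IsUnit B)
    (hB : FinQuiver.IsPseudoMorphism Q R B) :
    ∃ C : Matrix (Fin n) (Fin n) ℤ,
      Q.inc * (B * C) = R.inc ∧
      FinQuiver.starMatrix Q R (B * C) * (B * C) = 1 ∧
      IsStrongGramCongruence (B * C) Q.form R.form := by
  obtain ⟨hB1, hB2⟩ := hB
  have hBd : IsUnit B.det := (isUnit_iff_isUnit_det B).1 hunit
  have hRd : IsUnit R.upperGram.det := by rw [R.det_upperGram hR.loopless]; exact isUnit_one
  have hQd : IsUnit Q.upperGram.det := by rw [Q.det_upperGram hloop]; exact isUnit_one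
  have hu' : IsUnit (Bᵀ * Q.upperGram * B).det := by
    rw [det_mul, det_mul, det_transpose]
    exact (hBd.mul hQd).mul hBd
  obtain ⟨T, hT⟩ := hconn.exists_generalized_inverse
  -- As I(R) = I(Q) B, a generalized inverse for R comes from one for Q.
  obtain ⟨g, z, K, hK1, hK2, hK3, hK4⟩ := FinQuiver.exists_darboux_matrix hR.loopless
    (T := B⁻¹ * T) (by
      rw [← hB1, ← Matrix.mul_assoc (Q.inc * B), mul_nonsing_inv_cancel_right _ _ hBd,
        ← Matrix.mul_assoc, hT])
  -- The compatibility condition is I(R†) Bᵀ Ǧ_Q B = I(Q†) Ǧ_Q B = I(Q) B = I(R).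
  obtain ⟨D, hD1, hD2⟩ := exists_congr_of_darboux (G' := Bᵀ * Q.upperGram * B)
    R.upperGram_add_transpose (by
      rw [transpose_mul, transpose_mul, transpose_transpose, ← Matrix.mul_assoc Bᵀ,
        ← Matrix.add_mul, ← Matrix.mul_add, Q.upperGram_add_transpose, ← hB1, transpose_mul,
        FinQuiver.gram]
      simp only [Matrix.mul_assoc])
    ((isUnit_iff_isUnit_det _).2 hRd) ((isUnit_iff_isUnit_det _).2 hu') (by
      rw [← R.inc_dagger hR.loopless, ← Matrix.mul_assoc, ← Matrix.mul_assoc, hB2,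
        Q.inc_dagger hloop, nonsing_inv_mul_cancel_right _ _ hQd, hB1])
    hK1 hK2 hK3 hK4
  have hDd : IsUnit D.det := by
    rw [← hD2, det_mul] at hu'
    exact isUnit_of_mul_isUnit_right hu'
  have hDt : IsUnit Dᵀ.det := by rwa [det_transpose]
  have hinc : R.inc * D⁻¹ = R.inc := by
    conv_lhs => rw [← hD1, mul_nonsing_inv_cancel_right _ _ hDd]
  have hgram : (B * D⁻¹)ᵀ * Q.upperGram * (B * D⁻¹) = R.upperGram := by
    calc (B * D⁻¹)ᵀ * Q.upperGram * (B * D⁻¹) = (Dᵀ)⁻¹ * (Bᵀ * Q.upperGram * B) * D⁻¹ := by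
          rw [transpose_mul, transpose_nonsing_inv]
          simp only [Matrix.mul_assoc]
      _ = R.upperGram := by
          rw [← hD2, Matrix.mul_assoc Dᵀ, nonsing_inv_mul_cancel_left _ _ hDt,
            mul_nonsing_inv_cancel_right _ _ hDd]
  refine ⟨D⁻¹, ?_, ?_, FinQuiver.isUnitForm_form hloop, FinQuiver.isUnitForm_form hR.loopless,
    hunit.mul ?_, ?_⟩
  · rw [← Matrix.mul_assoc, hB1, hinc]
  · rw [FinQuiver.starMatrix, Matrix.mul_assoc, Matrix.mul_assoc, ← Matrix.mul_assoc (B * D⁻¹)ᵀ,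
      hgram, nonsing_inv_mul _ hRd]
  · exact (isUnit_iff_isUnit_det _).2 (isUnit_nonsing_inv_det D hDd)
  · rw [FinQuiver.upperTriangularGram_form, FinQuiver.upperTriangularGram_form, hgram]
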